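/- **Conventions.** $\mathbb T=(\mathbb R\cup\{\infty\},\min,+)$ is the tropical semiring; semirings and algebras are commutative. $K$ is a field with a valuation $v:K\to\mathbb T$, and $X=\operatorname{Spec}A$ is an affine $K$-scheme ($A$ any commutative $K$-algebra). For a commutative monoid with zero $M$ and a semiring $R$, $R[M]$ is the monoid algebra in which the monomial $x_0$ of the zero of $M$ is $0$ (so it is free over $R$ on the $x_m$, $m\ne 0$). $M$ is *integral* if $ab=ac$ and $a\neq0$ imply $b=c$. A closed embedding $X\hookrightarrow \operatorname{Spec}K[M]$ is a surjective $K$-algebra homomorphism $\varphi:K[M]\to A$; a morphism from $X\hookrightarrow\operatorname{Spec}K[M]$ to $X\hookrightarrow\operatorname{Spec}K[N]$ is a morphism $\operatorname{Spec}K[M]\to\operatorname{Spec}K[N]$ under $X$ induced by a homomorphism $N\to M$ of monoids with zero. For $g=\sum c_mx_m\in K[M]$ put $\operatorname{trop}(g)=\bigoplus v(c_m)\odot x_m$, and let $\operatorname{trop}(\ker\varphi)\subseteq\mathbb T[M]$ be the $\mathbb T$-submodule spanned by the $\operatorname{trop}(g)$, $g\in\ker\varphi$ (for integral $M$ this is the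 ideal that they generate). The bend congruence $\mathcal B(I)$ is the congruence generated by $f\sim f_{\widehat\beta}$ for $f\in I$ and $\beta$ in the support of $f$, where $f_{\widehat\beta}$ is $f$ with its $\beta$-term deleted. The scheme-theoretic tropicalization is $\mathrm{Trop}_\varphi(X)=\operatorname{Spec}\big(\mathbb T[M]/\mathcal B(\operatorname{trop}(\ker\varphi))\big)$; $\mathbb T$-schemes are regarded as functors on $\mathbb T$-algebras, so $\mathrm{Trop}_\varphi(X)(S)=\operatorname{Hom}_{\mathbb T\text{-alg}}\big(\mathbb T[M]/\mathcal B(\operatorname{trop}(\ker\varphi)),S\big)$, and $\mathrm{Trop}_\varphi(X)$ is functorial in $\varphi$. The set-theoretic tropicalization $\operatorname{trop}_\varphi(X)$ is the set of homomorphisms $p:M\to\mathbb T$ of monoids with zero such that, for every $f=\bigoplus c_mx_m\in\operatorname{trop}(\ker\varphi)$, the minimum of the $c_m+p(m)$ is $\infty$ or is attained at least twice. For a $\mathbb T$-algebra $S$, a *$v$-semivaluation on $A$ with values in $S$* is a map $w:A\to S$ with $w(1)=1$, $w(ab)=w(a)w(b)$, $w(\lambda a)=v(\lambda)w(a)$ for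 $\lambda\in K$, and $w(a)+w(b)+w(c)=w(a)+w(b)=w(b)+w(c)=w(a)+w(c)$ whenever $a+b+c=0$. The underlying set of the analytification $X^{\mathrm{an}}$ is the set of $v$-semivaluations on $A$ with values in $\mathbb T$. **Theorem.** Let $\mathrm{ev}:K[A]\to A$, $x_a\mapsto a$, where $A$ is viewed as a multiplicative monoid with zero, let $u:X\hookrightarrow\widehat X=\operatorname{Spec}K[A]$ be the corresponding closed embedding, and let $\mathcal V=\mathbb T[A]/\mathcal B(\operatorname{trop}(\ker\mathrm{ev}))$. 1. $u$ is an initial object of the category of closed embeddings of $X$ into schemes $\operatorname{Spec}K[M]$, $M$ a commutative monoid with zero. If $A$ is a domain, the monoid $A$ is integral and $u$ is also initial in the full subcategory of the embeddings with $M$ integral. 2. There is a canonical bijection $\operatorname{trop}_u(X)\cong X^{\mathrm{an}}$: a point $p:A\to\mathbb T$ corresponds to the semivaluation $a\mapsto p(a)$. - (2′) There is a canonical bijection $\mathrm{Trop}_u(X)(\mathbb T)\cong X^{\mathrm{an}}$, $h\mapsto(a\mapsto h(x_a))$. - (2″) For every $\mathbb T$-algebra $S$ there is a canonical bijection between $\mathrm{Trop}_u(X)(S)$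 and the set of $v$-semivaluations on $A$ with values in $S$, $h\mapsto(a\mapsto h(x_a))$. - (2‴) The map $A\to\mathcal V$, $a\mapsto x_a$, is a universal $v$-semivaluation: it is a $v$-semivaluation, and every $v$-semivaluation $w:A\to S$ factors through it by a unique $\mathbb T$-algebra homomorphism $\mathcal V\to S$. 3. If $A$ is a finitely generated $K$-algebra, then the canonical maps $\mathrm{Trop}_u(X)\to\mathrm{Trop}_\varphi(X)$ exhibit $\mathrm{Trop}_u(X)$ as the limit of the $\mathrm{Trop}_\varphi(X)$ over the category of all closed embeddings $\varphi:X\hookrightarrow\mathbb A^n=\operatorname{Spec}K[x_1,\dots,x_n]$ with $n$ finite, i.e. the full subcategory of the category of (1) on the embeddings whose monoid $M$ is isomorphic to $\mathbb N^n$ with a zero adjoined for some $n$. -/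

import Mathlib

open CategoryTheory CategoryTheory.Limits

universe u w s

noncomputable section

namespace TropLimit

/-- The tropical semiring `(ℝ ∪ {∞}, min, +)`. -/
abbrev Trp : Type := Tropical (WithTop ℝ)

section Contracted

variable {R : Type*} [CommSemiring R] {M : Type*} [CommMonoidWithZero M]

theorem coeff_mul_single_zero_of_ne (f : MonoidAlgebra R M) (c : R) {m : M} (hm : m ≠ 0) :
    (f * MonoidAlgebra.single 0 c).coeff m = 0 :=
  MonoidAlgebra.coeff_mul_single_of_forall_mul_ne _ _ (by simpa using hm.symm)

theorem coeff_mul_erase_zero (f g : MonoidAlgebra R M) {m : M} (hm : m ≠ 0) :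
    (f * g).coeff m = (f.erase 0 * g.erase 0).coeff m := by
  conv_lhs => rw [← MonoidAlgebra.erase_add_single 0 f, ← MonoidAlgebra.erase_add_single 0 g]
  rw [add_mul, mul_add, mul_comm (MonoidAlgebra.single 0 (f.coeff 0))]
  simp only [MonoidAlgebra.coeff_add, Finsupp.add_apply, coeff_mul_single_zero_of_ne _ _ hm,
    add_zero]

variable (R M) in
/-- The congruence on the monoid algebra `R[M]` that forgets the coefficient of the monomial
`x_0` of the zero of `M`, that is, the congruence `x_0 ∼ 0`. -/
def contractCon : RingCon (MonoidAlgebra R M) where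
  r f g := ∀ m : M, m ≠ 0 → f.coeff m = g.coeff m
  iseqv := ⟨fun _ _ _ => rfl, fun h m hm => (h m hm).symm,
    fun h h' m hm => (h m hm).trans (h' m hm)⟩
  add' h h' m hm := by simp [h m hm, h' m hm]
  mul' {f f' g g'} h h' m hm := by
    have key : ∀ {a b : MonoidAlgebra R M}, (∀ m : M, m ≠ 0 → a.coeff m = b.coeff m) →
        a.erase 0 = b.erase 0 := by
      intro a b hab
      ext m
      rcases eq_or_ne m 0 with rfl | hm
      · simp
      · simp [Finsupp.erase_ne hm, hab m hm]
    rw [coeff_mul_erase_zero f g hm, coeff_mul_erase_zero f' g' hm, key h, key h']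

variable (R M) in
/-- The algebra `R[M]` of a commutative monoid with zero `M`, in which the monomial of `0 : M`
is `0`; it is free as an `R`-module on the nonzero elements of `M`. -/
def MonAlg : Type _ := (contractCon R M).Quotient

namespace MonAlg

instance : CommSemiring (MonAlg R M) := inferInstanceAs (CommSemiring (contractCon R M).Quotient)

instance : Algebra R (MonAlg R M) := inferInstanceAs (Algebra R (contractCon R M).Quotient)

variable (R M) in
/-- The quotient map from the monoid algebra. -/
def ofMonoidAlgebra : MonoidAlgebra R M →ₐ[R] MonAlg R M := RingCon.mkₐ R (contractCon R M)

/-- The class of a formal linear combination of elements of `M`. -/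
def mk (f : M →₀ R) : MonAlg R M := ofMonoidAlgebra R M (MonoidAlgebra.ofCoeff f)

/-- The coefficients of an element of `R[M]`, indexed by `M` (with coefficient `0` at `0 : M`). -/
def coeff (F : MonAlg R M) : M →₀ R :=
  Quotient.liftOn' F (fun f => f.coeff.erase 0) (by
    intro f g h
    ext m
    rcases eq_or_ne m 0 with rfl | hm
    · simp
    · simpa [Finsupp.erase_ne hm] using h m hm)

variable (R) in
/-- The monomial `x_m`. -/
def mon : M →*₀ MonAlg R M where
  toFun m := mk (Finsupp.single m 1)
  map_zero' := by
    refine (RingCon.eq _).2 ?_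
    intro m hm
    simp [hm]
  map_one' := rfl
  map_mul' a b := by
    show ofMonoidAlgebra R M _ = ofMonoidAlgebra R M _ * ofMonoidAlgebra R M _
    rw [← map_mul]
    congr 1
    simp

/-- `F` with its `β`-monomial deleted. -/
def del (β : M) (F : MonAlg R M) : MonAlg R M := mk (F.coeff.erase β)

theorem coeff_mk (f : M →₀ R) : (mk f).coeff = f.erase 0 := rfl

theorem mk_coeff (F : MonAlg R M) : mk F.coeff = F := by
  induction F using Quotient.inductionOn' with
  | h f =>
    refine (RingCon.eq _).2 ?_
    intro m hm
    exact Finsupp.erase_ne hm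

theorem coeff_zero_apply (F : MonAlg R M) : F.coeff 0 = 0 := by
  rw [← mk_coeff F, coeff_mk]
  simp

theorem mk_add (f g : M →₀ R) : (mk (f + g) : MonAlg R M) = mk f + mk g := by
  simp only [mk, MonoidAlgebra.ofCoeff_add, map_add]

theorem mk_smul (c : R) (f : M →₀ R) : (mk (c • f) : MonAlg R M) = c • mk f := by
  simp only [mk, MonoidAlgebra.ofCoeff_smul, map_smul]

theorem coeff_add (F G : MonAlg R M) : (F + G).coeff = F.coeff + G.coeff := by
  conv_lhs => rw [← mk_coeff F, ← mk_coeff G, ← mk_add, coeff_mk]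
  rw [Finsupp.erase_of_notMem_support]
  simp [coeff_zero_apply]

theorem coeff_smul (c : R) (F : MonAlg R M) : (c • F).coeff = c • F.coeff := by
  conv_lhs => rw [← mk_coeff F, ← mk_smul, coeff_mk]
  rw [Finsupp.erase_of_notMem_support]
  simp [coeff_zero_apply]

theorem coeff_zero : (0 : MonAlg R M).coeff = 0 := by
  have := coeff_smul (0 : R) (0 : MonAlg R M)
  simpa using this

theorem mk_single (m : M) (c : R) : (mk (Finsupp.single m c) : MonAlg R M) = c • mon R m := by
  show _ = c • mk _
  rw [← mk_smul]
  simp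

theorem mk_eq_sum (f : M →₀ R) : (mk f : MonAlg R M) = f.sum fun m c => c • mon R m := by
  induction f using Finsupp.induction_linear with
  | zero => exact map_zero (ofMonoidAlgebra R M)
  | add f g hf hg =>
    rw [mk_add, hf, hg, Finsupp.sum_add_index']
    · simp
    · intros; rw [add_smul]
  | single m c => rw [mk_single, Finsupp.sum_single_index]; simp

theorem mon_mul (m : M) (F : MonAlg R M) :
    mon R m * F = mk (F.coeff.mapDomain (m * ·)) := by
  conv_lhs => rw [← mk_coeff F]
  rw [mk_eq_sum, mk_eq_sum,
    Finsupp.sum_mapDomain_index (by simp) (by intros; rw [add_smul]), Finsupp.mul_sum]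
  simp

/-- A morphism `M → B` of monoids with zero extends to an algebra homomorphism `R[M] → B`. -/
def lift {B : Type*} [CommSemiring B] [Algebra R B] (p : M →*₀ B) : MonAlg R M →ₐ[R] B :=
  (contractCon R M).liftₐ (MonoidAlgebra.lift R B M p.toMonoidHom) (by
    have key : ∀ f : MonoidAlgebra R M, MonoidAlgebra.lift R B M p.toMonoidHom f
        = MonoidAlgebra.lift R B M p.toMonoidHom (f.erase 0) := by
      intro f
      have h0 : MonoidAlgebra.lift R B M p.toMonoidHom
          (MonoidAlgebra.single 0 (f.coeff 0)) = 0 := by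
        rw [MonoidAlgebra.lift_single]
        exact (congrArg _ (map_zero p)).trans (smul_zero _)
      conv_lhs => rw [← MonoidAlgebra.erase_add_single 0 f, map_add, h0, add_zero]
    intro f g h
    show MonoidAlgebra.lift R B M p.toMonoidHom f = MonoidAlgebra.lift R B M p.toMonoidHom g
    rw [key f, key g]
    congr 1
    ext m
    rcases eq_or_ne m 0 with rfl | hm
    · simp
    · simpa [Finsupp.erase_ne hm] using h m hm)

theorem lift_mon {B : Type*} [CommSemiring B] [Algebra R B] (p : M →*₀ B) (m : M) :
    lift p (mon R m) = p m := by
  show MonoidAlgebra.lift R B M p.toMonoidHom (MonoidAlgebra.single m 1) = _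
  simp

theorem algHom_ext {B : Type*} [CommSemiring B] [Algebra R B] {f g : MonAlg R M →ₐ[R] B}
    (h : ∀ m, f (mon R m) = g (mon R m)) : f = g := by
  refine AlgHom.ext fun F => ?_
  rw [← mk_coeff F, mk_eq_sum]
  simp [map_finsuppSum, h]

/-- The algebra homomorphism `R[M] → R[N]`, `x_m ↦ x_{f m}`. -/
def map {N : Type*} [CommMonoidWithZero N] (f : M →*₀ N) : MonAlg R M →ₐ[R] MonAlg R N :=
  lift ((mon R).comp f)

theorem map_mon {N : Type*} [CommMonoidWithZero N] (f : M →*₀ N) (m : M) :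
    map f (mon R m) = mon R (f m) := lift_mon _ _

/-- For a commutative monoid `P`, adjoining a zero gives the usual monoid algebra `R[P]`; for
`P = ℕⁿ` it is the polynomial algebra in `n` variables. -/
def withZeroEquiv (P : Type*) [CommMonoid P] :
    MonAlg R (WithZero P) ≃ₐ[R] MonoidAlgebra R P :=
  AlgEquiv.ofAlgHom (lift (WithZero.lift' (MonoidAlgebra.of R P)))
    (MonoidAlgebra.lift R (MonAlg R (WithZero P)) P
      ((mon R : WithZero P →*₀ MonAlg R (WithZero P)).toMonoidHom.comp
        (WithZero.coeMonoidHom (α := P))))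
    (by
      apply MonoidAlgebra.algHom_ext
      · intro p
        rw [AlgHom.comp_apply, MonoidAlgebra.lift_single, one_smul]
        exact lift_mon _ _
      · exact Subsingleton.elim _ _)
    (by
      refine algHom_ext fun m => ?_
      rw [AlgHom.comp_apply, lift_mon]
      induction m using WithZero.recZeroCoe with
      | zero => simp
      | coe p =>
        rw [WithZero.lift'_coe, MonoidAlgebra.lift_of]
        rfl)

end MonAlg

end Contracted

section Tropicalization

variable {K : Type*} [Field K] (v : AddValuation K (WithTop ℝ))

/-- The valuation of `c`, as an element of the tropical semiring. -/
def val (c : K) : Trp := Tropical.trop (v c)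

theorem val_zero : val v 0 = 0 := by simp [val]

theorem val_mul (a b : K) : val v (a * b) = val v a * val v b := by simp [val]

theorem val_one : val v 1 = 1 := by simp [val]

theorem val_neg (a : K) : val v (-a) = val v a := by simp [val]

theorem val_add_absorb (a b : K) :
    val v (a + b) + (val v a + val v b) = val v a + val v b := by
  apply Tropical.add_eq_right
  rw [← Tropical.untrop_le_iff]
  simp [val, v.map_add a b]

variable {M : Type*} [CommMonoidWithZero M]

/-- The tropicalization of `g = ∑ c_m x_m ∈ K[M]`: the tropical sum of the `v(c_m) ⊙ x_m`. -/
def trop (g : MonAlg K M) : MonAlg Trp M :=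
  MonAlg.mk (g.coeff.mapRange (val v) (val_zero v))

/-- The tropicalization of a set of elements of `K[M]` (in practice, of an ideal `J`): the
`𝕋`-submodule of `𝕋[M]` spanned by the tropicalizations of its elements. When `M` is integral
and `J` an ideal, this is the ideal generated by these elements, by `coe_tropSpan_eq`. -/
def tropSpan (J : Ideal (MonAlg K M)) : Submodule Trp (MonAlg Trp M) :=
  Submodule.span Trp {F | ∃ g ∈ J, F = trop v g}

/-- The bend relations `f ∼ f_{β̂}` of all the elements `f` of `I`, for `β` in the support
of `f`. -/
def BendRel (I : Set (MonAlg Trp M)) (p q : MonAlg Trp M) : Prop :=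
  ∃ f ∈ I, ∃ β ∈ f.coeff.support, p = f ∧ q = f.del β

/-- The bend congruence of `I`: the congruence generated by the bend relations of the elements
of `I`. -/
def bendCon (I : Set (MonAlg Trp M)) : RingCon (MonAlg Trp M) :=
  ringConGen (BendRel I)

variable {A : Type*} [CommRing A] [Algebra K A]

/-- The `𝕋`-algebra `𝕋[M] / B(trop(ker φ))` of regular functions on the scheme-theoretic
tropicalization of `Spec A` with respect to `φ : K[M] → A`. -/
def TropAlg (φ : MonAlg K M →ₐ[K] A) : Type _ :=
  (bendCon (tropSpan v (RingHom.ker φ) : Set (MonAlg Trp M))).Quotient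

instance (φ : MonAlg K M →ₐ[K] A) : CommSemiring (TropAlg v φ) :=
  inferInstanceAs (CommSemiring
    (bendCon (tropSpan v (RingHom.ker φ) : Set (MonAlg Trp M))).Quotient)

instance (φ : MonAlg K M →ₐ[K] A) : Algebra Trp (TropAlg v φ) :=
  inferInstanceAs (Algebra Trp
    (bendCon (tropSpan v (RingHom.ker φ) : Set (MonAlg Trp M))).Quotient)

/-- The quotient map `𝕋[M] → 𝕋[M] / B(trop(ker φ))`. -/
def tropMk (φ : MonAlg K M →ₐ[K] A) : MonAlg Trp M →ₐ[Trp] TropAlg v φ :=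
  RingCon.mkₐ Trp (bendCon (tropSpan v (RingHom.ker φ) : Set (MonAlg Trp M)))

/-- A tropical polynomial `f ∈ 𝕋[M]` vanishes tropically at a `𝕋`-point `p : M → 𝕋` if the
minimum of the values at `p` of its terms is `∞` or is attained at least twice. -/
def TropVanishes (f : MonAlg Trp M) (p : M →*₀ Trp) : Prop :=
  (f.coeff.sum fun m c => c * p m) = 0 ∨
    ∃ β ∈ f.coeff.support, ∃ γ ∈ f.coeff.support, β ≠ γ ∧
      f.coeff β * p β = (f.coeff.sum fun m c => c * p m) ∧
      f.coeff γ * p γ = (f.coeff.sum fun m c => c * p m)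

/-- The set-theoretic tropicalization of `Spec A` with respect to `φ : K[M] → A`: the intersection
of the tropical hypersurfaces of the elements of `trop(ker φ)`, inside the set of `𝕋`-points of
`Spec 𝕋[M]`, i.e. of morphisms `M → 𝕋` of monoids with zero. -/
def setTrop (φ : MonAlg K M →ₐ[K] A) : Set (M →*₀ Trp) :=
  {p | ∀ f ∈ tropSpan v (RingHom.ker φ), TropVanishes f p}

end Tropicalization

section Functoriality

variable {K : Type*} [Field K] {v : AddValuation K (WithTop ℝ)}
variable {M : Type*} [CommMonoidWithZero M] {A : Type*} [CommRing A] [Algebra K A]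

theorem trop_add_self (a : Trp) : a + a = a := Tropical.add_self a

theorem smul_add_self {Q : Type*} [CommSemiring Q] [Algebra Trp Q] (q : Q) : q + q = q := by
  have h : ((1 : Trp) + 1) • q = (1 : Trp) • q := by rw [trop_add_self]
  rwa [add_smul, one_smul] at h

theorem del_mk (β : M) (f : M →₀ Trp) : (MonAlg.mk f).del β = MonAlg.mk (f.erase β) := by
  refine (RingCon.eq _).2 ?_
  intro m hm
  rw [MonAlg.coeff_mk]
  rcases eq_or_ne m β with rfl | h
  · simp
  · simp [Finsupp.erase_ne h, Finsupp.erase_ne hm]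

theorem del_add (β : M) (F G : MonAlg Trp M) : (F + G).del β = F.del β + G.del β := by
  simp only [MonAlg.del, MonAlg.coeff_add, Finsupp.erase_add, MonAlg.mk_add]

theorem del_smul (β : M) (c : Trp) (F : MonAlg Trp M) : (c • F).del β = c • F.del β := by
  rw [MonAlg.del, MonAlg.del, MonAlg.coeff_smul, ← MonAlg.mk_smul]
  congr 1
  ext m
  rcases eq_or_ne m β with rfl | h
  · simp
  · simp [Finsupp.erase_ne h]

theorem del_zero (β : M) : (0 : MonAlg Trp M).del β = 0 := by
  have := del_smul β 0 (0 : MonAlg Trp M)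
  simpa using this

/-- Bend relations of a spanning set suffice. -/
theorem bendCon_span_le (I : Set (MonAlg Trp M)) (C : RingCon (MonAlg Trp M))
    (h : ∀ f ∈ I, ∀ β, C f (f.del β)) :
    bendCon (Submodule.span Trp I : Set (MonAlg Trp M)) ≤ C := by
  refine RingCon.ringConGen_le.2 ?_
  rintro p q ⟨f, hf, β, -, rfl, rfl⟩
  rename_i f
  induction hf using Submodule.span_induction with
  | mem f hf => exact h f hf β
  | zero => rw [del_zero]; exact C.refl _
  | add f g _ _ hf hg => rw [del_add]; exact C.add hf hg
  | smul c f _ hf =>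
    rw [del_smul, Algebra.smul_def, Algebra.smul_def]
    exact C.mul (C.refl _) hf

theorem tropMk_bend (φ : MonAlg K M →ₐ[K] A) {f : MonAlg Trp M}
    (hf : f ∈ tropSpan v (RingHom.ker φ)) (β : M) :
    tropMk v φ f = tropMk v φ (f.del β) := by
  by_cases hβ : β ∈ f.coeff.support
  · exact (RingCon.eq _).2 (RingCon.le_ringConGen _ _ ⟨f, hf, β, hβ, rfl, rfl⟩)
  · rw [MonAlg.del, Finsupp.erase_of_notMem_support hβ, MonAlg.mk_coeff]

theorem trop_eq_sum (g : MonAlg K M) :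
    trop v g = ∑ m ∈ g.coeff.support, val v (g.coeff m) • MonAlg.mon Trp m := by
  rw [trop, MonAlg.mk_eq_sum, Finsupp.sum_mapRange_index (by simp)]
  rfl

theorem trop_del_eq_sum [DecidableEq M] (g : MonAlg K M) (β : M) :
    (trop v g).del β
      = ∑ m ∈ g.coeff.support.erase β, val v (g.coeff m) • MonAlg.mon Trp m := by
  have h : (g.coeff.mapRange (val v) (val_zero v)).erase β
      = (g.coeff.erase β).mapRange (val v) (val_zero v) := by
    ext m
    rcases eq_or_ne m β with rfl | h
    · simp [val_zero]
    · simp [Finsupp.erase_ne h]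
  rw [trop, del_mk, h, MonAlg.mk_eq_sum,
    Finsupp.sum_mapRange_index (by simp), Finsupp.sum, Finsupp.support_erase]
  refine Finset.sum_congr rfl fun m hm => ?_
  rw [Finsupp.erase_ne (Finset.ne_of_mem_erase hm)]

theorem val_sum_absorb {ι : Type*} (s : Finset ι) (c : ι → K) :
    val v (∑ i ∈ s, c i) + ∑ i ∈ s, val v (c i) = ∑ i ∈ s, val v (c i) := by
  classical
  induction s using Finset.induction_on with
  | empty => simp [val_zero]
  | insert a s ha ih =>
    rw [Finset.sum_insert ha, Finset.sum_insert ha]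
    have h := val_add_absorb v (c a) (∑ i ∈ s, c i)
    generalize val v (c a + ∑ i ∈ s, c i) = x at h ⊢
    generalize val v (∑ i ∈ s, c i) = y at h ih
    generalize ∑ i ∈ s, val v (c i) = z at ih ⊢
    rw [← ih, ← add_assoc (val v (c a)), ← add_assoc x, h]

theorem sum_absorb {Q : Type*} [CommSemiring Q] [Algebra Trp Q] {ι : Type*} {s t : Finset ι}
    (hst : s ⊆ t) (y : ι → Q) : ∑ i ∈ s, y i + ∑ i ∈ t, y i = ∑ i ∈ t, y i := by
  classical
  rw [← Finset.sum_sdiff hst, add_comm, add_assoc, smul_add_self]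

theorem map_coeff_apply {N : Type*} [CommMonoidWithZero N] [DecidableEq N] (f : M →*₀ N)
    (g : MonAlg K M) {n : N} (hn : n ≠ 0) :
    (MonAlg.map f g).coeff n = ∑ m ∈ g.coeff.support with f m = n, g.coeff m := by
  have h : MonAlg.map f g = MonAlg.mk (g.coeff.mapDomain f) := by
    conv_lhs => rw [← MonAlg.mk_coeff g, MonAlg.mk_eq_sum, map_finsuppSum]
    rw [MonAlg.mk_eq_sum, Finsupp.sum_mapDomain_index (by simp) (by intros; rw [add_smul])]
    simp [MonAlg.map_mon]
  rw [h, MonAlg.coeff_mk, Finsupp.erase_ne hn, Finsupp.mapDomain, Finsupp.sum_apply,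
    Finsupp.sum, Finset.sum_filter]
  simp [Finsupp.single_apply]

theorem tropMk_map_bend {N : Type*} [CommMonoidWithZero N] (f : M →*₀ N)
    (φ : MonAlg K M →ₐ[K] A) (ψ : MonAlg K N →ₐ[K] A) (h : ψ.comp (MonAlg.map f) = φ)
    {g : MonAlg K M} (hg : g ∈ RingHom.ker φ) (β : M) :
    tropMk v ψ (MonAlg.map f (trop v g)) = tropMk v ψ (MonAlg.map f ((trop v g).del β)) := by
  classical
  by_cases hβ : β ∈ g.coeff.support
  swap
  · have h0 : (trop v g).del β = trop v g := by
      rw [trop_del_eq_sum, Finset.erase_eq_of_notMem hβ, ← trop_eq_sum]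
    rw [h0]
  -- the class `y n` of the monomial `x_n`
  set y : N → TropAlg v ψ := fun n => tropMk v ψ (MonAlg.mon Trp n) with hy
  set s := g.coeff.support with hs
  have hsum : ∀ t : Finset M, tropMk v ψ (MonAlg.map f
      (∑ m ∈ t, val v (g.coeff m) • MonAlg.mon Trp m))
      = ∑ m ∈ t, val v (g.coeff m) • y (f m) := by
    intro t
    simp only [map_sum, map_smul, MonAlg.map_mon, hy]
  rw [trop_del_eq_sum, trop_eq_sum, hsum, hsum, ← hs, ← Finset.add_sum_erase s _ hβ]
  set T := ∑ m ∈ s.erase β, val v (g.coeff m) • y (f m) with hT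
  rcases eq_or_ne (f β) 0 with h0 | h0
  · have : y (f β) = 0 := by simp only [hy, h0, map_zero]
    rw [this, smul_zero, zero_add]
  set n := f β with hn
  set G := MonAlg.map f g with hG
  have hGker : G ∈ RingHom.ker ψ := by
    rw [RingHom.mem_ker] at hg ⊢
    rw [← h] at hg
    exact hg
  -- the terms of `trop G` other than the one at `n` are absorbed by `T`
  have hterm : ∀ n', n' ≠ n → val v (G.coeff n') • y n' + T = T := by
    intro n' hn'
    rcases eq_or_ne n' 0 with rfl | hn0
    · have : y 0 = 0 := by simp only [hy, map_zero]
      rw [this, smul_zero, zero_add]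
    · rw [hG, map_coeff_apply f g hn0]
      have h1 : (s.filter fun m => f m = n') ⊆ s.erase β := by
        intro m hm
        rw [Finset.mem_filter] at hm
        refine Finset.mem_erase.2 ⟨?_, hm.1⟩
        rintro rfl
        exact hn' hm.2.symm
      have h2 := sum_absorb h1 fun m => val v (g.coeff m) • y (f m)
      rw [← hT] at h2
      have h3 : ∑ m ∈ s with f m = n', val v (g.coeff m) • y (f m)
          = (∑ m ∈ s with f m = n', val v (g.coeff m)) • y n' := by
        rw [Finset.sum_smul]
        refine Finset.sum_congr rfl fun m hm => ?_
        rw [(Finset.mem_filter.1 hm).2]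
      rw [h3] at h2
      rw [← h2, ← add_assoc, ← add_smul, val_sum_absorb]
  have hD : ∀ t : Finset N, (∀ n' ∈ t, n' ≠ n) →
      ∑ n' ∈ t, val v (G.coeff n') • y n' + T = T := by
    intro t
    induction t using Finset.induction_on with
    | empty => intro _; simp
    | insert a t ha ih =>
      intro ht
      rw [Finset.sum_insert ha, add_assoc, ih fun n' h' => ht n' (Finset.mem_insert_of_mem h')]
      exact hterm a (ht a (Finset.mem_insert_self a t))
  -- so is the term at `n`, by a bend relation of `trop G`
  have hGn : val v (G.coeff n) • y n + T = T := by
    by_cases hGs : n ∈ G.coeff.support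
    · have hb := tropMk_bend (v := v) ψ
        (Submodule.subset_span ⟨G, hGker, rfl⟩ : trop v G ∈ tropSpan v (RingHom.ker ψ)) n
      rw [trop_del_eq_sum, trop_eq_sum, ← Finset.add_sum_erase _ _ hGs] at hb
      simp only [map_add, map_sum, map_smul] at hb
      have hE := hD (G.coeff.support.erase n) fun n' h' => Finset.ne_of_mem_erase h'
      change val v (G.coeff n) • y n + ∑ n' ∈ G.coeff.support.erase n,
        val v (G.coeff n') • y n' = ∑ n' ∈ G.coeff.support.erase n,
        val v (G.coeff n') • y n' at hb
      rw [← hE, ← add_assoc, hb]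
    · rw [Finsupp.notMem_support_iff.1 hGs, val_zero, zero_smul, zero_add]
  -- the coefficient of `β` is a difference of coefficients that have been dealt with
  have hfib : (s.filter fun m => f m = n).erase β ⊆ s.erase β :=
    Finset.erase_subset_erase _ (Finset.filter_subset _ _)
  have hF := sum_absorb hfib fun m => val v (g.coeff m) • y (f m)
  rw [← hT] at hF
  have h3 : ∑ m ∈ (s.filter fun m => f m = n).erase β, val v (g.coeff m) • y (f m)
      = (∑ m ∈ (s.filter fun m => f m = n).erase β, val v (g.coeff m)) • y n := by
    rw [Finset.sum_smul]
    refine Finset.sum_congr rfl fun m hm => ?_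
    rw [(Finset.mem_filter.1 (Finset.mem_of_mem_erase hm)).2]
  rw [h3] at hF
  have hc : g.coeff β = G.coeff n
      + -∑ m ∈ (s.filter fun m => f m = n).erase β, g.coeff m := by
    rw [hG, map_coeff_apply f g h0, ← Finset.add_sum_erase (s.filter fun m => f m = n) _
      (Finset.mem_filter.2 ⟨hβ, rfl⟩)]
    simp
  have h4 := val_add_absorb v (G.coeff n)
    (-∑ m ∈ (s.filter fun m => f m = n).erase β, g.coeff m)
  rw [← hc, val_neg] at h4
  have h5 := val_sum_absorb (v := v) ((s.filter fun m => f m = n).erase β) fun m => g.coeff m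
  have h6 : (val v (g.coeff β) + (val v (G.coeff n)
      + ∑ m ∈ (s.filter fun m => f m = n).erase β, val v (g.coeff m))) =
      val v (G.coeff n) + ∑ m ∈ (s.filter fun m => f m = n).erase β, val v (g.coeff m) := by
    rw [← h5, ← add_assoc (val v (G.coeff n)), ← add_assoc, h4]
  have h7 : (val v (G.coeff n) + ∑ m ∈ (s.filter fun m => f m = n).erase β,
      val v (g.coeff m)) • y n + T = T := by
    rw [add_smul, add_assoc, hF, hGn]
  rw [← h7, ← add_assoc, ← add_smul, h6]

/-- A morphism `f : M → N` of monoids with zero over `A` induces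
`𝕋[M]/B(trop(ker φ)) → 𝕋[N]/B(trop(ker ψ))`, `x_m ↦ x_{f m}`. -/
def tropMap (v : AddValuation K (WithTop ℝ)) {N : Type*} [CommMonoidWithZero N] (f : M →*₀ N)
    (φ : MonAlg K M →ₐ[K] A) (ψ : MonAlg K N →ₐ[K] A) (h : ψ.comp (MonAlg.map f) = φ) :
    TropAlg v φ →ₐ[Trp] TropAlg v ψ :=
  RingCon.liftₐ _ ((tropMk v ψ).comp (MonAlg.map f)) (bendCon_span_le _ _ (by
    rintro _ ⟨g, hg, rfl⟩ β
    exact tropMk_map_bend f φ ψ h hg β))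

theorem tropMap_tropMk {N : Type*} [CommMonoidWithZero N] (f : M →*₀ N)
    (φ : MonAlg K M →ₐ[K] A) (ψ : MonAlg K N →ₐ[K] A) (h : ψ.comp (MonAlg.map f) = φ)
    (F : MonAlg Trp M) : tropMap v f φ ψ h (tropMk v φ F) = tropMk v ψ (MonAlg.map f F) := rfl

theorem tropAlg_hom_ext {φ : MonAlg K M →ₐ[K] A} {B : Type*} [CommSemiring B] [Algebra Trp B]
    {f g : TropAlg v φ →ₐ[Trp] B}
    (h : ∀ m, f (tropMk v φ (MonAlg.mon Trp m)) = g (tropMk v φ (MonAlg.mon Trp m))) : f = g := by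
  have h' : f.comp (tropMk v φ) = g.comp (tropMk v φ) := MonAlg.algHom_ext h
  refine AlgHom.ext fun x => ?_
  obtain ⟨F, rfl⟩ := RingCon.mkₐ_surjective (α := Trp) _ x
  exact DFunLike.congr_fun h' F

theorem tropMap_id (φ : MonAlg K M →ₐ[K] A)
    (h : φ.comp (MonAlg.map (MonoidWithZeroHom.id M)) = φ) :
    tropMap v (MonoidWithZeroHom.id M) φ φ h = AlgHom.id Trp _ := by
  refine tropAlg_hom_ext fun m => ?_
  rw [tropMap_tropMk, MonAlg.map_mon]
  rfl

theorem tropMap_comp {N P : Type*} [CommMonoidWithZero N] [CommMonoidWithZero P]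
    (f : M →*₀ N) (g : N →*₀ P) (φ : MonAlg K M →ₐ[K] A) (ψ : MonAlg K N →ₐ[K] A)
    (χ : MonAlg K P →ₐ[K] A) (hf : ψ.comp (MonAlg.map f) = φ) (hg : χ.comp (MonAlg.map g) = ψ)
    (h : χ.comp (MonAlg.map (g.comp f)) = φ) :
    tropMap v (g.comp f) φ χ h = (tropMap v g ψ χ hg).comp (tropMap v f φ ψ hf) := by
  refine tropAlg_hom_ext fun m => ?_
  rw [AlgHom.comp_apply, tropMap_tropMk, tropMap_tropMk, tropMap_tropMk, MonAlg.map_mon,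
    MonAlg.map_mon, MonAlg.map_mon]
  rfl

theorem mon_mul_trop [IsCancelMulZero M] (m : M) (g : MonAlg K M) :
    MonAlg.mon Trp m * trop v g = trop v (MonAlg.mon K m * g) := by
  classical
  rcases eq_or_ne m 0 with rfl | hm
  · simp [trop, MonAlg.coeff_zero]
    exact (map_zero (MonAlg.ofMonoidAlgebra Trp M)).symm
  have hinj : Function.Injective (m * · : M → M) := mul_right_injective₀ hm
  rw [MonAlg.mon_mul, MonAlg.mon_mul, trop, trop, MonAlg.coeff_mk, MonAlg.coeff_mk]
  congr 1
  ext n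
  have hz : ∀ F : M →₀ Trp, F 0 = 0 → (F.mapDomain (m * ·)) 0 = 0 := by
    intro F hF
    have := Finsupp.mapDomain_apply hinj F 0
    simpa [hF] using this
  by_cases hn : n ∈ Set.range (m * · : M → M)
  · obtain ⟨k, rfl⟩ := hn
    rcases eq_or_ne k 0 with rfl | hk
    · simp only [mul_zero, Finsupp.mapRange_apply, Finsupp.erase_same, val_zero]
      exact hz _ (by simp)
    · have hmk : m * k ≠ 0 := mul_ne_zero hm hk
      rw [Finsupp.mapRange_apply, Finsupp.erase_ne hmk]
      show Finsupp.mapDomain (m * ·) _ ((m * ·) k) = val v (Finsupp.mapDomain (m * ·) _ ((m * ·) k))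
      rw [Finsupp.mapDomain_apply hinj, Finsupp.mapDomain_apply hinj, Finsupp.erase_ne hk,
        Finsupp.mapRange_apply]
  · rw [Finsupp.mapDomain_of_notMem_range _ _ hn, Finsupp.mapRange_apply]
    rcases eq_or_ne n 0 with rfl | hn0
    · simp [val_zero]
    · rw [Finsupp.erase_ne hn0, Finsupp.mapDomain_of_notMem_range _ _ hn, val_zero]

/-- For `M` integral, the tropicalization of an ideal of `K[M]` is the ideal of `𝕋[M]` generated
by the tropicalizations of its elements. -/
theorem coe_tropSpan_eq [IsCancelMulZero M] (J : Ideal (MonAlg K M)) :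
    (tropSpan v J : Set (MonAlg Trp M)) = (Ideal.span {F | ∃ g ∈ J, F = trop v g} : Set _) := by
  have hmul : ∀ F : MonAlg Trp M, ∀ G ∈ tropSpan v J, F * G ∈ tropSpan v J := by
    intro F G hG
    rw [← MonAlg.mk_coeff F, MonAlg.mk_eq_sum, Finsupp.sum_mul]
    refine Submodule.sum_mem _ fun m _ => ?_
    show (F.coeff m • MonAlg.mon Trp m) * G ∈ tropSpan v J
    rw [smul_mul_assoc]
    refine Submodule.smul_mem _ _ ?_
    induction hG using Submodule.span_induction with
    | mem G hG =>
      obtain ⟨g, hg, rfl⟩ := hG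
      exact Submodule.subset_span ⟨_, J.mul_mem_left _ hg, mon_mul_trop m g⟩
    | zero => rw [mul_zero]; exact Submodule.zero_mem _
    | add G G' _ _ hG hG' => rw [mul_add]; exact Submodule.add_mem _ hG hG'
    | smul c G _ hG => rw [mul_smul_comm]; exact Submodule.smul_mem _ _ hG
  apply Set.Subset.antisymm
  · have : tropSpan v J ≤ (Ideal.span {F | ∃ g ∈ J, F = trop v g}).restrictScalars Trp :=
      Submodule.span_le.2 Ideal.subset_span
    exact this
  · intro F hF
    induction hF using Submodule.span_induction with
    | mem G hG => exact Submodule.subset_span hG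
    | zero => exact Submodule.zero_mem _
    | add G G' _ _ hG hG' => exact Submodule.add_mem _ hG hG'
    | smul c G _ hG => exact hmul c G hG

end Functoriality

section Semivaluations

variable {K : Type*} [Field K] (v : AddValuation K (WithTop ℝ))

/-- A `v`-semivaluation on the `K`-algebra `A` with values in the `𝕋`-algebra `S`: a map
`w : A → S` with `w(1) = 1`, `w(ab) = w(a) w(b)` and `w(λa) = v(λ) w(a)`, such that
`w(a) + w(b) + w(c)` bends whenever `a + b + c = 0`, i.e. the sum does not change when one of its
three terms is deleted. -/
@[ext]
structure VSemivaluation (A : Type*) [CommRing A] [Algebra K A]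
    (S : Type*) [CommSemiring S] [Algebra Trp S] where
  toFun : A → S
  map_one : toFun 1 = 1
  map_mul : ∀ a b, toFun (a * b) = toFun a * toFun b
  map_smul : ∀ (c : K) (a : A), toFun (c • a) = val v c • toFun a
  bends : ∀ a b c, a + b + c = 0 →
    toFun a + toFun b + toFun c = toFun a + toFun b ∧
    toFun a + toFun b + toFun c = toFun b + toFun c ∧
    toFun a + toFun b + toFun c = toFun a + toFun c

instance (A : Type*) [CommRing A] [Algebra K A] (S : Type*) [CommSemiring S] [Algebra Trp S] :
    CoeFun (VSemivaluation v A S) (fun _ => A → S) := ⟨VSemivaluation.toFun⟩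

/-- The underlying set of the Berkovich analytification of `Spec A`. -/
abbrev Analytification (A : Type*) [CommRing A] [Algebra K A] : Type _ :=
  VSemivaluation v A Trp

end Semivaluations

section Categories

/-- Commutative `𝕋`-algebras. -/
structure TAlg : Type (u + 1) where
  carrier : Type u
  [commSemiring : CommSemiring carrier]
  [algebra : Algebra Trp carrier]

attribute [instance] TAlg.commSemiring TAlg.algebra

instance : Category TAlg.{u} where
  Hom B C := B.carrier →ₐ[Trp] C.carrier
  id B := AlgHom.id Trp B.carrier
  comp f g := g.comp f

variable (K : Type w) [Field K] (A : Type u) [CommRing A] [Algebra K A]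

/-- Closed embeddings of `Spec A` into `Spec K[M]`, for `M` a commutative monoid with zero. -/
structure Emb where
  M : Type u
  [monoid : CommMonoidWithZero M]
  φ : MonAlg K M →ₐ[K] A
  surj : Function.Surjective φ

attribute [instance] Emb.monoid

variable {K A}

/-- A morphism from `Spec A ↪ Spec K[M]` to `Spec A ↪ Spec K[N]`: a morphism
`Spec K[M] → Spec K[N]` under `Spec A` that is given by a morphism `N → M` of monoids with zero. -/
@[ext]
structure Emb.Hom (Y Z : Emb.{u, w} K A) where
  f : Z.M →*₀ Y.M
  comm : Y.φ.comp (MonAlg.map f) = Z.φ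

instance : Category (Emb.{u, w} K A) where
  Hom := Emb.Hom
  id Y := ⟨MonoidWithZeroHom.id Y.M, MonAlg.algHom_ext fun m => by simp [MonAlg.map_mon]⟩
  comp {X Y Z} p q := ⟨p.f.comp q.f, MonAlg.algHom_ext fun m => by
    rw [← q.comm, ← p.comm]
    simp [MonAlg.map_mon]⟩

/-- Ambient schemes `Spec K[M]` with `M` integral (nonzero elements can be cancelled). -/
def isIntegral : ObjectProperty (Emb.{u, w} K A) := fun Y => IsCancelMulZero Y.M

/-- Ambient schemes that are affine spaces: `M` is `ℕⁿ` (the monomials in `n` variables) with a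
zero adjoined. -/
def isAffineSpace : ObjectProperty (Emb.{u, w} K A) := fun Y =>
  ∃ n : ℕ, Nonempty (Y.M ≃* WithZero (Multiplicative (Fin n →₀ ℕ)))

variable (K A)

/-- The evaluation map `K[A] → A`, `x_a ↦ a`, where `A` is viewed as a multiplicative monoid. -/
def ev : MonAlg K A →ₐ[K] A := MonAlg.lift (MonoidWithZeroHom.id A)

theorem ev_mon (a : A) : ev K A (MonAlg.mon K a) = a := MonAlg.lift_mon _ _

/-- The embedding `u : X → X̂ = Spec K[A]` given by the evaluation map. -/
def hat : Emb.{u, w} K A where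
  M := A
  φ := ev K A
  surj a := ⟨_, ev_mon K A a⟩

variable {K A}

/-- The morphism from `u : X → X̂` to any other embedding, given by `m ↦ φ(x_m)`. -/
def hatTo (Y : Emb.{u, w} K A) : hat K A ⟶ Y where
  f := (Y.φ : MonAlg K Y.M →+* A).toMonoidWithZeroHom.comp (MonAlg.mon K)
  comm := MonAlg.algHom_ext fun _ =>
    (congrArg (ev K A) (MonAlg.map_mon _ _)).trans (ev_mon K A _)

theorem hatTo_unique {Y : Emb.{u, w} K A} (h : hat K A ⟶ Y) : h = hatTo Y := by
  have h0 : ∀ m, h.f m = Y.φ (MonAlg.mon K m) := fun m => by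
    have h1 := DFunLike.congr_fun h.comm (MonAlg.mon K m)
    rw [AlgHom.comp_apply, MonAlg.map_mon] at h1
    exact (ev_mon K A _).symm.trans h1
  exact Emb.Hom.ext (MonoidWithZeroHom.ext h0)

/-- The functor that sends an embedding `φ` to the `𝕋`-algebra of regular functions on the
scheme-theoretic tropicalization. -/
def tropAlgFunctor (v : AddValuation K (WithTop ℝ)) : Emb.{u, w} K A ⥤ TAlg.{u}ᵒᵖ where
  obj Y := Opposite.op ⟨TropAlg v Y.φ⟩
  map {Y Z} h := Quiver.Hom.op (X := (⟨TropAlg v Z.φ⟩ : TAlg.{u})) (Y := ⟨TropAlg v Y.φ⟩)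
    (tropMap v h.f Z.φ Y.φ h.comm)
  map_id Y := congrArg Quiver.Hom.op (tropMap_id (v := v) Y.φ _)
  map_comp {X Y Z} p q := congrArg Quiver.Hom.op
    (tropMap_comp (v := v) q.f p.f Z.φ Y.φ X.φ q.comm p.comm _)

/-- The scheme-theoretic tropicalization `Trop_φ(X) = Spec (𝕋[M] / B(trop(ker φ)))`, as a functor
of the embedding `φ`. Schemes over `𝕋` are viewed through their functors of points on
`𝕋`-algebras: `Trop_φ(X)(S)` is the set of `𝕋`-algebra homomorphisms
`𝕋[M] / B(trop(ker φ)) → S`. -/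
def tropScheme (v : AddValuation K (WithTop ℝ)) : Emb.{u, w} K A ⥤ (TAlg.{u} ⥤ Type u) :=
  tropAlgFunctor v ⋙ coyoneda

/-- The canonical cone with apex `Trop_u(X)` over the tropicalizations `Trop_φ(X)`, for `φ` in the
category of embeddings of `X` into affine spaces. -/
def tropCone (v : AddValuation K (WithTop ℝ)) :
    Cone ((isAffineSpace (K := K) (A := A)).ι ⋙ tropScheme v) where
  pt := (tropScheme v).obj (hat K A)
  π :=
    { app := fun Y => (tropScheme v).map (hatTo Y.obj)
      naturality := fun Y Z h => by
        show 𝟙 _ ≫ (tropScheme v).map _ = (tropScheme v).map _ ≫ (tropScheme v).map _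
        rw [Category.id_comp, ← Functor.map_comp]
        exact congrArg _ (hatTo_unique _).symm }

end Categories

end TropLimit

end

open TropLimit CategoryTheory CategoryTheory.Limits

/-! A morphism from the evaluation embedding to φ : K[M] → A is a map of monoids M → A compatible
with the evaluation, so it has to be m ↦ φ(x_m), and this map always works. Hence u is initial.

The statements about points rest on one fact: the bend congruence of trop(ker ev) is generated by
the relations x_{λa} ∼ v(λ) x_a and by the bend relations of x_a + x_b + x_c for a + b + c = 0.
These relations hold because they come from linear relations with two or three terms between
elements of A; `tropMk_sum_bend` also covers the case of coinciding monomials. Conversely, if ∑ c_a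
a = 0, then each term is minus the sum of the others. By repeated use of the three-term axiom, the
value of a sum is absorbed by the sum of the values (`VSemivaluation.map_sum_absorb`), so deleting
one term changes nothing (`VSemivaluation.lift_trop_bend`). Homomorphisms out of the quotient are
therefore the same as semivaluations (`pointsEquiv`). As 𝕋 is totally ordered, the bend relations of
a finite sum in 𝕋 say that its minimum is ∞ or is attained twice, so the set-theoretic
tropicalization consists of the 𝕋-points (`setTropEquiv`).

For the limit, a compatible family of S-points is glued to a semivaluation on A. If A is finitely
generated, any finite set of its elements can be included among the images of the variables of an
embedding into an affine space (`exists_affine_forall_mem`), and two such embeddings are dominated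
by a third (`exists_finset_forall_hom`). The value at a is read off from any monomial over a. Each
axiom involves at most three elements, so it can be checked in a single affine space
(`existsUnique_semivaluation`). -/

noncomputable section

namespace TropLimit

/-! ### Free commutative monoids with zero -/

section FreeMonoid

variable {ι : Type*}

/-- The free commutative monoid with zero on `ι`: monomials in variables indexed by `ι`, and `0`. -/
abbrev FreeMon (ι : Type*) : Type _ := WithZero (Multiplicative (ι →₀ ℕ))

/-- The generators of `FreeMon ι`. -/
def FreeMon.gen : ι ↪ FreeMon ι where
  toFun i := ((Multiplicative.ofAdd (Finsupp.single i 1) : Multiplicative (ι →₀ ℕ)) : FreeMon ι)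
  inj' i j h := by
    have h1 := Multiplicative.ofAdd.injective (WithZero.coe_injective h)
    exact Finsupp.single_left_injective one_ne_zero h1

theorem FreeMon.gen_ne_zero (i : ι) : FreeMon.gen i ≠ 0 := WithZero.coe_ne_zero

variable {N : Type*} [CommMonoidWithZero N]

/-- A family of elements of `N` extends to a morphism `FreeMon ι → N`. -/
def FreeMon.lift (a : ι → N) : FreeMon ι →*₀ N :=
  WithZero.lift'
    { toFun := fun x => x.toAdd.prod fun i k => a i ^ k
      map_one' := Finsupp.prod_zero_index
      map_mul' := fun _ _ => Finsupp.prod_add_index' (by simp) (by intros; rw [pow_add]) }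

theorem FreeMon.lift_gen (a : ι → N) (i : ι) : FreeMon.lift a (FreeMon.gen i) = a i := by
  refine (WithZero.lift'_coe _ _).trans ?_
  exact (Finsupp.prod_single_index (h := fun i k => a i ^ k) (pow_zero (a i))).trans (pow_one (a i))

theorem FreeMon.hom_ext {f g : FreeMon ι →*₀ N}
    (h : ∀ i, f (FreeMon.gen i) = g (FreeMon.gen i)) : f = g := by
  refine MonoidWithZeroHom.ext fun x => ?_
  induction x using WithZero.recZeroCoe with
  | zero => simp
  | coe x =>
    induction x using Multiplicative.rec with
    | ofAdd x =>
    induction x using Finsupp.induction_linear with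
    | zero => exact (map_one f).trans (map_one g).symm
    | add x y hx hy => rw [ofAdd_add, WithZero.coe_mul, map_mul, map_mul, hx, hy]
    | single i n =>
      have : ((Multiplicative.ofAdd (Finsupp.single i n) : Multiplicative (ι →₀ ℕ)) : FreeMon ι)
          = FreeMon.gen i ^ n := by
        show _ = ((Multiplicative.ofAdd (Finsupp.single i 1) : Multiplicative (ι →₀ ℕ)) :
          FreeMon ι) ^ n
        rw [← WithZero.coe_pow, ← ofAdd_nsmul, Finsupp.smul_single, nsmul_one, Nat.cast_id]
      rw [this, map_pow, map_pow, h]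

end FreeMonoid

/-! ### Bend relations from linear relations between monomials -/

section Bend

variable {K : Type*} [Field K] {v : AddValuation K (WithTop ℝ)}
variable {M : Type*} [CommMonoidWithZero M] {A : Type*} [CommRing A] [Algebra K A]

/-- A linear relation between monomials in `A` gives bend relations, even if some of
the monomials coincide. -/
theorem tropMk_sum_bend {ι : Type*} [Fintype ι] [DecidableEq ι] (φ : MonAlg K M →ₐ[K] A)
    (c : ι → K) (m : ι → M) (h : ∑ i, c i • φ (MonAlg.mon K (m i)) = 0) (j : ι) :
    ∑ i, val v (c i) • tropMk v φ (MonAlg.mon Trp (m i))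
      = ∑ i ∈ Finset.univ.erase j, val v (c i) • tropMk v φ (MonAlg.mon Trp (m i)) := by
  classical
  -- The relation is lifted to a linear form in independent variables, one for each index. Its
  -- monomials are distinct even if the `m i` are not, so no coefficients are merged.
  set F : FreeMon ι →₀ K := (Finsupp.equivFunOnFinite.symm c).embDomain FreeMon.gen with hF
  set s : Finset ι := (Finsupp.equivFunOnFinite.symm c).support with hs
  have hcF : (MonAlg.mk F : MonAlg K (FreeMon ι)).coeff = F := by
    rw [MonAlg.coeff_mk, Finsupp.erase_of_notMem_support]
    simp [hF, FreeMon.gen_ne_zero]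
  have hFi : ∀ i, F (FreeMon.gen i) = c i := fun i => by
    rw [hF, Finsupp.embDomain_apply_self]; rfl
  have hsupp : (MonAlg.mk F : MonAlg K (FreeMon ι)).coeff.support = s.map FreeMon.gen := by
    rw [hcF, hF, Finsupp.support_embDomain]
  have hker : (MonAlg.mk F : MonAlg K (FreeMon ι))
      ∈ RingHom.ker (φ.comp (MonAlg.map (FreeMon.lift m))) := by
    rw [RingHom.mem_ker, ← h, MonAlg.mk_eq_sum, hF, Finsupp.sum_embDomain,
      Finsupp.sum_fintype _ _ (by simp)]
    simp only [map_sum, map_smul, AlgHom.comp_apply, MonAlg.map_mon, FreeMon.lift_gen]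
    rfl
  -- The bend relation of the lifted form survives the substitution of `m i` for the i-th variable.
  have key := tropMk_map_bend (v := v) (FreeMon.lift m) _ φ rfl hker (FreeMon.gen j)
  rw [trop_del_eq_sum, trop_eq_sum, hsupp, ← Finset.map_erase, Finset.sum_map,
    Finset.sum_map] at key
  simp only [map_sum, map_smul, MonAlg.map_mon, FreeMon.lift_gen, hcF, hFi] at key
  -- The sums in `key` run over the support only; the missing terms have coefficient v(0) = ∞, the
  -- zero of 𝕋.
  have hz : ∀ i, i ∉ s → val v (c i) • tropMk v φ (MonAlg.mon Trp (m i)) = 0 := by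
    intro i hi
    have : c i = 0 := by simpa [hs] using hi
    rw [this, val_zero, zero_smul]
  rw [Finset.sum_subset (Finset.subset_univ s) fun i _ hi => hz i hi] at key
  rw [key]
  refine Finset.sum_subset (Finset.erase_subset_erase _ (Finset.subset_univ s)) ?_
  intro i hi hi'
  refine hz i fun h => hi' ?_
  exact Finset.mem_erase.2 ⟨Finset.ne_of_mem_erase hi, h⟩

/-- The class of a monomial only depends on its image in `A`, up to scalars. -/
theorem tropMk_mon_eq_smul (φ : MonAlg K M →ₐ[K] A) {c : K} {m n : M}
    (h : φ (MonAlg.mon K m) = c • φ (MonAlg.mon K n)) :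
    tropMk v φ (MonAlg.mon Trp m) = val v c • tropMk v φ (MonAlg.mon Trp n) := by
  -- In a relation with two terms, deleting either one leaves the other, so both are equal to the
  -- full sum.
  have hs : ∑ i : Fin 2, (![1, -c] i) • φ (MonAlg.mon K (![m, n] i)) = 0 := by
    simp [Fin.sum_univ_two, h]
  have h0 := tropMk_sum_bend (v := v) φ _ _ hs 0
  have h1 := tropMk_sum_bend (v := v) φ _ _ hs 1
  rw [h0, show Finset.univ.erase (0 : Fin 2) = {1} from rfl,
    show Finset.univ.erase (1 : Fin 2) = {0} from rfl] at h1
  simpa [val_neg, val_one] using h1.symm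

/-- The case of the scalar 1. It makes the values of a glued semivaluation independent of the
monomial chosen over an element of A. -/
theorem tropMk_mon_eq (φ : MonAlg K M →ₐ[K] A) {m n : M}
    (h : φ (MonAlg.mon K m) = φ (MonAlg.mon K n)) :
    tropMk v φ (MonAlg.mon Trp m) = tropMk v φ (MonAlg.mon Trp n) := by
  simpa [val_one] using tropMk_mon_eq_smul (v := v) φ (c := 1) (by simpa using h)

/-- This is the additive axiom of a semivaluation. As l, m, n may coincide, it is derived from the
version for indexed families and not directly from an element of the kernel, in which equal
monomials would be collected. -/
theorem tropMk_mon_bends (φ : MonAlg K M →ₐ[K] A) {l m n : M}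
    (h : φ (MonAlg.mon K l) + φ (MonAlg.mon K m) + φ (MonAlg.mon K n) = 0) :
    let y := fun m => tropMk v φ (MonAlg.mon Trp m)
    y l + y m + y n = y l + y m ∧ y l + y m + y n = y m + y n ∧ y l + y m + y n = y l + y n := by
  intro y
  have hs : ∑ i : Fin 3, (1 : K) • φ (MonAlg.mon K (![l, m, n] i)) = 0 := by
    simp [Fin.sum_univ_three, h]
  have hb := tropMk_sum_bend (v := v) φ (fun _ => 1) ![l, m, n] hs
  have h0 := hb 0
  have h1 := hb 1
  have h2 := hb 2
  rw [show Finset.univ.erase (0 : Fin 3) = {1, 2} from rfl, Finset.sum_pair (by decide)] at h0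
  rw [show Finset.univ.erase (1 : Fin 3) = {0, 2} from rfl, Finset.sum_pair (by decide)] at h1
  rw [show Finset.univ.erase (2 : Fin 3) = {0, 1} from rfl, Finset.sum_pair (by decide)] at h2
  simp only [Fin.sum_univ_three, val_one, one_smul] at h0 h1 h2
  exact ⟨h2, h0, h1⟩

end Bend

/-! ### Semivaluations as points of the scheme-theoretic tropicalization -/

section Universal

variable {K : Type*} [Field K] {v : AddValuation K (WithTop ℝ)} {A : Type*} [CommRing A]
  [Algebra K A] {S : Type*} [CommSemiring S] [Algebra Trp S]

namespace VSemivaluation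

theorem map_zero (x : VSemivaluation v A S) : x 0 = 0 := by
  have := x.map_smul 0 0
  rwa [zero_smul, val_zero, zero_smul] at this

theorem map_neg (x : VSemivaluation v A S) (a : A) : x (-a) = x a := by
  have := x.map_smul (-1) a
  rwa [neg_one_smul, val_neg, val_one, one_smul] at this

/-- Apply the three-term axiom to a, b, −(a + b). Over 𝕋 this is the ultrametric inequality, since p
+ q = q in 𝕋 means p ≥ q. -/
theorem map_add_absorb (x : VSemivaluation v A S) (a b : A) :
    x (a + b) + (x a + x b) = x a + x b := by
  have := (x.bends a b (-(a + b)) (by ring)).1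
  rwa [x.map_neg, add_comm] at this

theorem map_sum_absorb (x : VSemivaluation v A S) {ι : Type*} (s : Finset ι) (a : ι → A) :
    x (∑ i ∈ s, a i) + ∑ i ∈ s, x (a i) = ∑ i ∈ s, x (a i) := by
  classical
  induction s using Finset.induction_on with
  | empty => simp [x.map_zero]
  | insert j s hj ih =>
    rw [Finset.sum_insert hj, Finset.sum_insert hj]
    -- By induction the value of the partial sum may be inserted for free; the absorption law for
    -- two terms then applies.
    calc x (a j + ∑ i ∈ s, a i) + (x (a j) + ∑ i ∈ s, x (a i))
        = x (a j + ∑ i ∈ s, a i) + (x (a j) + x (∑ i ∈ s, a i)) + ∑ i ∈ s, x (a i) := by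
          rw [add_assoc, add_assoc, ih]
      _ = x (a j) + ∑ i ∈ s, x (a i) := by rw [x.map_add_absorb, add_assoc, ih]

/-- A semivaluation, as a morphism of monoids with zero. -/
def toHom (x : VSemivaluation v A S) : A →*₀ S where
  toFun := x
  map_zero' := x.map_zero
  map_one' := x.map_one
  map_mul' := x.map_mul

/-- By homogeneity the terms of trop(g) take the values x(c_a a), where ∑ c_a a = 0. The term at β
is the value of minus the sum of the other c_a a, so it is absorbed by their values. -/
theorem lift_trop_bend (x : VSemivaluation v A S) {g : MonAlg K A}
    (hg : g ∈ RingHom.ker (ev K A)) (β : A) :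
    MonAlg.lift x.toHom (trop v g) = MonAlg.lift x.toHom ((trop v g).del β) := by
  classical
  have hx : ∀ (c : K) (a : A), val v c • x.toHom a = x (c • a) := fun c a => (x.map_smul c a).symm
  rw [trop_del_eq_sum, trop_eq_sum]
  simp only [map_sum, _root_.map_smul, MonAlg.lift_mon, hx]
  by_cases hβ : β ∈ g.coeff.support
  swap
  · rw [Finset.erase_eq_of_notMem hβ]
  have h0 : ∑ a ∈ g.coeff.support, g.coeff a • a = 0 := by
    rw [RingHom.mem_ker, ← MonAlg.mk_coeff g, MonAlg.mk_eq_sum, Finsupp.sum] at hg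
    simpa [ev_mon] using hg
  rw [← Finset.add_sum_erase _ _ hβ] at h0 ⊢
  rw [eq_neg_of_add_eq_zero_left h0, x.map_neg, x.map_sum_absorb]

/-- The homomorphism on `𝕋[A]/B(trop(ker ev))` induced by a semivaluation. -/
def toAlgHom (x : VSemivaluation v A S) : TropAlg v (ev K A) →ₐ[Trp] S :=
  RingCon.liftₐ _ (MonAlg.lift x.toHom) (bendCon_span_le _ _ (by
    rintro _ ⟨g, hg, rfl⟩ β
    exact x.lift_trop_bend hg β))

theorem toAlgHom_mon (x : VSemivaluation v A S) (a : A) :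
    x.toAlgHom (tropMk v (ev K A) (MonAlg.mon Trp a)) = x a :=
  MonAlg.lift_mon x.toHom a

end VSemivaluation

variable (v A) in
/-- The universal semivaluation `a ↦ x_a`. -/
def univSemivaluation : VSemivaluation v A (TropAlg v (ev K A)) where
  toFun a := tropMk v (ev K A) (MonAlg.mon Trp a)
  map_one := by simp
  map_mul a b := by simp
  map_smul c a := tropMk_mon_eq_smul _ (by simp only [ev_mon])
  bends a b c h := tropMk_mon_bends _ (by simpa only [ev_mon] using h)

/-- The push-forward of a semivaluation. -/
def VSemivaluation.comp {B : Type*} [CommSemiring B] [Algebra Trp B] (h : B →ₐ[Trp] S)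
    (x : VSemivaluation v A B) : VSemivaluation v A S where
  toFun a := h (x a)
  map_one := by rw [x.map_one, _root_.map_one]
  map_mul a b := by rw [x.map_mul, _root_.map_mul]
  map_smul c a := by rw [x.map_smul, _root_.map_smul]
  bends a b c habc := by
    have := x.bends a b c habc
    simp only [← map_add]
    exact ⟨congrArg h this.1, congrArg h this.2.1, congrArg h this.2.2⟩

variable (v A S) in
/-- Points of `Trop_u(X)` with values in `S` are semivaluations with values in `S`. -/
def pointsEquiv : (TropAlg v (ev K A) →ₐ[Trp] S) ≃ VSemivaluation v A S where
  toFun h := (univSemivaluation v A).comp h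
  invFun x := x.toAlgHom
  left_inv _ := tropAlg_hom_ext fun a => VSemivaluation.toAlgHom_mon _ a
  right_inv x := VSemivaluation.ext (funext fun a => x.toAlgHom_mon a)

end Universal

/-! ### Set-theoretic tropicalization and 𝕋-points -/

section SetTheoretic

theorem exists_eq_sum_trp {ι : Type*} {s : Finset ι} (hs : s.Nonempty) (y : ι → Trp) :
    ∃ i ∈ s, y i = ∑ i ∈ s, y i := by
  classical
  induction hs using Finset.Nonempty.cons_induction with
  | singleton a => exact ⟨a, by simp⟩
  | cons a s ha hs ih =>
    obtain ⟨i, hi, h⟩ := ih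
    rw [Finset.sum_cons]
    rcases Tropical.add_eq_iff.1 (rfl : y a + ∑ i ∈ s, y i = _) with h' | h'
    · exact ⟨a, Finset.mem_cons_self _ _, h'.1⟩
    · exact ⟨i, Finset.mem_cons_of_mem hi, h.trans h'.1⟩

/-- In `𝕋`, all the bend relations of a sum hold if and only if the sum is `∞` or the minimum is
attained twice. -/
theorem forall_sum_erase_eq_iff {ι : Type*} [DecidableEq ι] (s : Finset ι) (y : ι → Trp) :
    (∀ j ∈ s, ∑ i ∈ s, y i = ∑ i ∈ s.erase j, y i) ↔
      (∑ i ∈ s, y i = 0 ∨ ∃ j ∈ s, ∃ k ∈ s, j ≠ k ∧ y j = ∑ i ∈ s, y i ∧ y k = ∑ i ∈ s, y i) := by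
  constructor
  · intro h
    rcases s.eq_empty_or_nonempty with rfl | hs
    · exact Or.inl Finset.sum_empty
    -- A first minimum is attained at j. Deleting j does not change the sum, so the minimum k of the
    -- remaining terms is a second one.
    obtain ⟨j, hj, hj'⟩ := exists_eq_sum_trp hs y
    rcases (s.erase j).eq_empty_or_nonempty with he | he
    · exact Or.inl (by rw [h j hj, he, Finset.sum_empty])
    obtain ⟨k, hk, hk'⟩ := exists_eq_sum_trp he y
    exact Or.inr ⟨j, hj, k, Finset.mem_of_mem_erase hk, (Finset.ne_of_mem_erase hk).symm, hj',
      hk'.trans (h j hj).symm⟩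
  · rintro h j hj
    have hsum := Finset.add_sum_erase s y hj
    -- A minimal term other than the deleted one keeps the sum unchanged.
    have key : ∀ k ∈ s, j ≠ k → y k = ∑ i ∈ s, y i → ∑ i ∈ s, y i = ∑ i ∈ s.erase j, y i := by
      intro k hk hjk hyk
      have h1 := sum_absorb (Finset.singleton_subset_iff.2
        (Finset.mem_erase.2 ⟨hjk.symm, hk⟩)) y
      rw [Finset.sum_singleton, hyk, ← hsum, add_assoc, trop_add_self] at h1
      rw [← hsum, h1]
    rcases h with h | ⟨k, hk, l, hl, hkl, hyk, hyl⟩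
    · rw [h] at hsum ⊢
      exact (Tropical.add_eq_zero_iff.1 hsum).2.symm
    · by_cases hjk : j = k
      · exact key l hl (hjk ▸ hkl) hyl
      · exact key k hk hjk hyk

variable {M : Type*} [CommMonoidWithZero M]

theorem lift_eq_sum (p : M →*₀ Trp) (f : MonAlg Trp M) :
    MonAlg.lift p f = f.coeff.sum fun m c => c * p m := by
  conv_lhs => rw [← MonAlg.mk_coeff f, MonAlg.mk_eq_sum, map_finsuppSum]
  simp only [map_smul, MonAlg.lift_mon, smul_eq_mul]

theorem lift_del_eq_sum [DecidableEq M] (p : M →*₀ Trp) (f : MonAlg Trp M) (β : M) :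
    MonAlg.lift p (f.del β) = ∑ m ∈ f.coeff.support.erase β, f.coeff m * p m := by
  rw [MonAlg.del, MonAlg.mk_eq_sum, Finsupp.sum, Finsupp.support_erase, map_sum]
  refine Finset.sum_congr rfl fun m hm => ?_
  rw [Finsupp.erase_ne (Finset.ne_of_mem_erase hm), map_smul, MonAlg.lift_mon, smul_eq_mul]

theorem tropVanishes_iff (f : MonAlg Trp M) (p : M →*₀ Trp) :
    TropVanishes f p ↔ ∀ β ∈ f.coeff.support, MonAlg.lift p f = MonAlg.lift p (f.del β) := by
  classical
  simp only [lift_del_eq_sum]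
  rw [lift_eq_sum]
  exact (forall_sum_erase_eq_iff f.coeff.support fun m => f.coeff m * p m).symm

variable {K : Type*} [Field K] (v : AddValuation K (WithTop ℝ)) {A : Type*} [CommRing A]
  [Algebra K A]

/-- The set-theoretic tropicalization is the set of `𝕋`-points of the scheme-theoretic one. -/
def setTropEquiv (φ : MonAlg K M →ₐ[K] A) : setTrop v φ ≃ (TropAlg v φ →ₐ[Trp] Trp) where
  toFun p := RingCon.liftₐ _ (MonAlg.lift p.1) (RingCon.ringConGen_le.2 (by
    rintro f _ ⟨_, hf, β, hβ, rfl, rfl⟩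
    exact (tropVanishes_iff f p.1).1 (p.2 f hf) β hβ))
  invFun h := ⟨((h.comp (tropMk v φ) : MonAlg Trp M →+* Trp).toMonoidWithZeroHom).comp
      (MonAlg.mon Trp), fun f hf => (tropVanishes_iff _ _).2 fun β _ => by
    -- The restriction of a homomorphism to the monomials extends back to that homomorphism, which
    -- respects the bend relations.
    have hl : MonAlg.lift (((h.comp (tropMk v φ) : MonAlg Trp M →+* Trp).toMonoidWithZeroHom).comp
        (MonAlg.mon Trp)) = h.comp (tropMk v φ) :=
      MonAlg.algHom_ext fun m => MonAlg.lift_mon _ _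
    rw [hl]
    exact congrArg h (tropMk_bend φ hf β)⟩
  left_inv p := Subtype.ext (MonoidWithZeroHom.ext fun m => MonAlg.lift_mon p.1 m)
  right_inv h := tropAlg_hom_ext fun m => MonAlg.lift_mon _ m

theorem setTropEquiv_mon (φ : MonAlg K M →ₐ[K] A) (p : setTrop v φ) (m : M) :
    setTropEquiv v φ p (tropMk v φ (MonAlg.mon Trp m)) = p.1 m :=
  MonAlg.lift_mon p.1 m

end SetTheoretic

/-! ### Initiality of the evaluation embedding -/

section Initial

variable (K : Type w) [Field K] (A : Type u) [CommRing A] [Algebra K A]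

/-- The embedding `u` is initial. -/
def hatIsInitial : IsInitial (hat K A) := IsInitial.ofUniqueHom hatTo fun _ h => hatTo_unique h

theorem isIntegral_hat [IsDomain A] : isIntegral (hat K A) :=
  inferInstanceAs (IsCancelMulZero A)

/-- The embedding `u` is initial in any full subcategory that contains it. -/
def hatIsInitialFull (P : ObjectProperty (Emb.{u, w} K A)) (h : P (hat K A)) :
    IsInitial (⟨hat K A, h⟩ : P.FullSubcategory) :=
  IsInitial.ofUniqueHom (fun Y => ObjectProperty.homMk (hatTo Y.obj)) fun _ _ =>
    InducedCategory.hom_ext (hatTo_unique _)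

end Initial

/-! ### The limit over embeddings into affine spaces -/

section AffineSpaces

variable {K : Type w} [Field K] {A : Type u} [CommRing A] [Algebra K A]

/-- The morphism `m ↦ φ(x_m)` to the multiplicative monoid of `A`. -/
def monHom {M : Type*} [CommMonoidWithZero M] (φ : MonAlg K M →ₐ[K] A) : M →*₀ A :=
  (φ : MonAlg K M →+* A).toMonoidWithZeroHom.comp (MonAlg.mon K)

/-- For an embedding `Y` into an affine space there is a morphism `Z ⟶ Y` as soon as the monomials
of `Z` represent finitely many elements of `A`, the images of the variables of `Y`. -/
theorem exists_finset_forall_hom {Y : Emb.{u, w} K A} (hY : isAffineSpace Y) :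
    ∃ T : Finset A, ∀ Z : Emb.{u, w} K A,
      (∀ t ∈ T, ∃ m, Z.φ (MonAlg.mon K m) = t) → Nonempty (Z ⟶ Y) := by
  classical
  obtain ⟨n, ⟨e⟩⟩ := hY
  let e0 : Y.M →*₀ FreeMon (Fin n) := MonoidWithZeroHom.ofClass e
  let e1 : FreeMon (Fin n) →*₀ Y.M := MonoidWithZeroHom.ofClass e.symm
  refine ⟨Finset.univ.image fun i => Y.φ (MonAlg.mon K (e1 (FreeMon.gen i))), fun Z hZ => ?_⟩
  have h := fun i : Fin n => hZ _ (Finset.mem_image_of_mem _ (Finset.mem_univ i))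
  -- A monomial of `Z` is chosen over the image of each variable of `Y`. By freeness any choice
  -- extends to all monomials, and compatibility with the maps to A needs checking on the variables
  -- only.
  choose a ha using h
  have key : (monHom Z.φ).comp (FreeMon.lift a)
      = (monHom Y.φ).comp e1 :=
    FreeMon.hom_ext fun i => by
      show Z.φ (MonAlg.mon K (FreeMon.lift a (FreeMon.gen i))) = _
      rw [FreeMon.lift_gen]
      exact ha i
  refine ⟨⟨(FreeMon.lift a).comp e0, MonAlg.algHom_ext fun m => ?_⟩⟩
  rw [AlgHom.comp_apply, MonAlg.map_mon]
  refine (DFunLike.congr_fun key (e0 m)).trans ?_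
  show Y.φ (MonAlg.mon K (e.symm (e m))) = _
  rw [MulEquiv.symm_apply_apply]

/-- Every finite subset of a finitely generated algebra is in the image of the monomials, for some
embedding into an affine space. -/
theorem exists_affine_forall_mem [Algebra.FiniteType K A] (T : Finset A) :
    ∃ Y : Emb.{u, w} K A, isAffineSpace Y ∧ ∀ t ∈ T, ∃ m, Y.φ (MonAlg.mon K m) = t := by
  classical
  obtain ⟨G, hG⟩ := Algebra.FiniteType.out (R := K) (A := A)
  -- There is one variable for each element of `G ∪ T`: the generators `G` give surjectivity, and
  -- `T` consists of the prescribed images.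
  set b : Fin (G ∪ T).card → A := fun i => ((G ∪ T).equivFin.symm i : A) with hb
  have hbmem : ∀ t ∈ G ∪ T, ∃ i, b i = t := fun t ht => ⟨(G ∪ T).equivFin ⟨t, ht⟩, by simp [hb]⟩
  -- The monoid of an embedding has to live in the universe of A.
  let e : ULift.{u} (FreeMon (Fin (G ∪ T).card)) ≃* FreeMon (Fin (G ∪ T).card) := MulEquiv.ulift
  let φ : MonAlg K (ULift.{u} (FreeMon (Fin (G ∪ T).card))) →ₐ[K] A :=
    MonAlg.lift ((FreeMon.lift b).comp (MonoidWithZeroHom.ofClass e))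
  have hφ : ∀ t ∈ G ∪ T, ∃ m, φ (MonAlg.mon K m) = t := by
    intro t ht
    obtain ⟨i, rfl⟩ := hbmem t ht
    exact ⟨e.symm (FreeMon.gen i), (MonAlg.lift_mon _ _).trans (FreeMon.lift_gen b i)⟩
  have hsurj : Function.Surjective φ := by
    rw [← AlgHom.range_eq_top, eq_top_iff, ← hG, Algebra.adjoin_le_iff]
    intro t ht
    obtain ⟨m, hm⟩ := hφ t (Finset.mem_union_left _ ht)
    exact ⟨_, hm⟩
  exact ⟨⟨_, φ, hsurj⟩, ⟨_, ⟨e⟩⟩, fun t ht => hφ t (Finset.mem_union_right _ ht)⟩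

variable {v : AddValuation K (WithTop ℝ)} {S : Type*} [CommSemiring S] [Algebra Trp S]

/-- A compatible family of `S`-points of the tropicalizations, over all the embeddings into affine
spaces, comes from a unique semivaluation. -/
theorem existsUnique_semivaluation [Algebra.FiniteType K A]
    (h : ∀ Y : Emb.{u, w} K A, isAffineSpace Y → (TropAlg v Y.φ →ₐ[Trp] S))
    (hcomp : ∀ (Y Z : Emb.{u, w} K A) (hY : isAffineSpace Y) (hZ : isAffineSpace Z) (f : Y ⟶ Z),
      (h Y hY).comp (tropMap v f.f Z.φ Y.φ f.comm) = h Z hZ) :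
    ∃! x : VSemivaluation v A S, ∀ Y hY m,
      x (Y.φ (MonAlg.mon K m)) = h Y hY (tropMk v Y.φ (MonAlg.mon Trp m)) := by
  classical
  have hf : ∀ (Y Z : Emb.{u, w} K A) (hY : isAffineSpace Y) (hZ : isAffineSpace Z) (f : Y ⟶ Z) m,
      h Z hZ (tropMk v Z.φ (MonAlg.mon Trp m))
        = h Y hY (tropMk v Y.φ (MonAlg.mon Trp (f.f m))) := by
    intro Y Z hY hZ f m
    rw [← hcomp Y Z hY hZ f, AlgHom.comp_apply, tropMap_tropMk, MonAlg.map_mon]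
  have hφ : ∀ (Y Z : Emb.{u, w} K A) (f : Y ⟶ Z) m,
      Y.φ (MonAlg.mon K (f.f m)) = Z.φ (MonAlg.mon K m) := by
    intro Y Z f m
    rw [← MonAlg.map_mon]
    exact DFunLike.congr_fun f.comm _
  -- The value depends only on the element of A: both monomials are moved to an embedding `W` that
  -- maps to `Y` and to `Z`.
  have hwd : ∀ (Y Z : Emb.{u, w} K A) (hY : isAffineSpace Y) (hZ : isAffineSpace Z) m n,
      Y.φ (MonAlg.mon K m) = Z.φ (MonAlg.mon K n) →
      h Y hY (tropMk v Y.φ (MonAlg.mon Trp m)) = h Z hZ (tropMk v Z.φ (MonAlg.mon Trp n)) := by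
    intro Y Z hY hZ m n hmn
    obtain ⟨T, hT⟩ := exists_finset_forall_hom hY
    obtain ⟨T', hT'⟩ := exists_finset_forall_hom hZ
    obtain ⟨W, hW, hmem⟩ := exists_affine_forall_mem (K := K) (T ∪ T')
    obtain ⟨f⟩ := hT W fun t ht => hmem t (Finset.mem_union_left _ ht)
    obtain ⟨g⟩ := hT' W fun t ht => hmem t (Finset.mem_union_right _ ht)
    rw [hf W Y hW hY f, hf W Z hW hZ g]
    congr 1
    -- The two monomials of `W` may be different, but they have the same image in A, hence the same
    -- class.
    exact tropMk_mon_eq _ (by rw [hφ, hφ, hmn])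
  have hex : ∀ a : A, ∃ s : S, ∀ Y hY m, Y.φ (MonAlg.mon K m) = a →
      s = h Y hY (tropMk v Y.φ (MonAlg.mon Trp m)) := by
    intro a
    obtain ⟨W, hW, hmem⟩ := exists_affine_forall_mem (K := K) {a}
    obtain ⟨n, hn⟩ := hmem a (Finset.mem_singleton_self a)
    exact ⟨_, fun Y hY m hm => hwd W Y hW hY n m (hn.trans hm.symm)⟩
  choose x hx using hex
  refine ⟨⟨x, ?_, ?_, ?_, ?_⟩, fun Y hY m => hx _ Y hY m rfl, ?_⟩
  · obtain ⟨W, hW, -⟩ := exists_affine_forall_mem (K := K) (∅ : Finset A)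
    rw [hx 1 W hW 1 (by simp)]
    simp
  · intro a b
    obtain ⟨W, hW, hmem⟩ := exists_affine_forall_mem (K := K) {a, b}
    obtain ⟨l, hl⟩ := hmem a (by simp)
    obtain ⟨m, hm⟩ := hmem b (by simp)
    rw [hx a W hW l hl, hx b W hW m hm, hx (a * b) W hW (l * m) (by simp [hl, hm])]
    simp
  · intro c a
    -- Unlike a product, c • a need not be the image of a monomial just because a is, so it gets a
    -- variable of its own.
    obtain ⟨W, hW, hmem⟩ := exists_affine_forall_mem (K := K) {a, c • a}
    obtain ⟨l, hl⟩ := hmem a (by simp)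
    obtain ⟨m, hm⟩ := hmem (c • a) (by simp)
    rw [hx a W hW l hl, hx (c • a) W hW m hm, ← map_smul]
    exact congrArg _ (tropMk_mon_eq_smul _ (by rw [hl, hm]))
  · intro a b c habc
    obtain ⟨W, hW, hmem⟩ := exists_affine_forall_mem (K := K) {a, b, c}
    obtain ⟨l, hl⟩ := hmem a (by simp)
    obtain ⟨m, hm⟩ := hmem b (by simp)
    obtain ⟨n, hn⟩ := hmem c (by simp)
    have := tropMk_mon_bends (v := v) W.φ (l := l) (m := m) (n := n) (by rw [hl, hm, hn, habc])
    rw [hx a W hW l hl, hx b W hW m hm, hx c W hW n hn]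
    simp only [← map_add]
    exact ⟨congrArg _ this.1, congrArg _ this.2.1, congrArg _ this.2.2⟩
  · intro y hy
    refine VSemivaluation.ext (funext fun a => ?_)
    obtain ⟨W, hW, hmem⟩ := exists_affine_forall_mem (K := K) {a}
    obtain ⟨n, hn⟩ := hmem a (Finset.mem_singleton_self a)
    show y a = x a
    rw [hx a W hW n hn, ← hy W hW n, hn]

/-- This turns compatibility with the legs of the cone into the condition that characterizes the
semivaluation in `existsUnique_semivaluation`. -/
theorem comp_tropMap_hatTo (g : TropAlg v (hat K A).φ →ₐ[Trp] S) (Y : Emb.{u, w} K A) (m : Y.M) :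
    g.comp (tropMap v (hatTo Y).f Y.φ (hat K A).φ (hatTo Y).comm)
        (tropMk v Y.φ (MonAlg.mon Trp m))
      = g (tropMk v (ev K A) (MonAlg.mon Trp (Y.φ (MonAlg.mon K m)))) :=
  congrArg g (congrArg (tropMk v (ev K A)) (MonAlg.map_mon _ _))

/-- The tropicalization `Trop_u(X)` is the limit of the tropicalizations with respect to embeddings
into affine spaces. -/
theorem nonempty_isLimit_tropCone (v : AddValuation K (WithTop ℝ)) [Algebra.FiniteType K A] :
    Nonempty (IsLimit (tropCone (K := K) (A := A) v)) := by
  -- Limits of functors are checked pointwise. For each S, what remains is that every compatible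
  -- family of S-points comes from a unique S-point of the apex.
  refine ⟨evaluationJointlyReflectsLimits _ fun S => Nonempty.some ?_⟩
  rw [Types.isLimit_iff]
  intro σ hσ
  let h : ∀ Y : Emb.{u, w} K A, isAffineSpace Y → (TropAlg v Y.φ →ₐ[Trp] S.carrier) :=
    fun Y hY => σ ⟨Y, hY⟩
  have hcomp : ∀ (Y Z : Emb.{u, w} K A) (hY : isAffineSpace Y) (hZ : isAffineSpace Z) (f : Y ⟶ Z),
      (h Y hY).comp (tropMap v f.f Z.φ Y.φ f.comm) = h Z hZ := fun Y Z hY hZ f =>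
    hσ (j := ⟨Y, hY⟩) (j' := ⟨Z, hZ⟩) (ObjectProperty.homMk f)
  obtain ⟨x, hx, huniq⟩ := existsUnique_semivaluation h hcomp
  refine ⟨x.toAlgHom, fun Y => ?_, fun g hg => ?_⟩
  · exact tropAlg_hom_ext fun m => (comp_tropMap_hatTo x.toAlgHom Y.obj m).trans
      ((x.toAlgHom_mon _).trans (hx Y.obj Y.property m))
  -- Two points of the apex are equal once their semivaluations are, and `huniq` determines the
  -- latter.
  · refine (pointsEquiv v A S.carrier).injective ((huniq _ fun Y hY m => ?_).trans
      ((pointsEquiv v A S.carrier).right_inv x).symm)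
    exact (comp_tropMap_hatTo (S := S.carrier) g Y m).symm.trans
      (DFunLike.congr_fun (F := TropAlg v Y.φ →ₐ[Trp] S.carrier) (hg ⟨Y, hY⟩)
        (tropMk v Y.φ (MonAlg.mon Trp m)))

end AffineSpaces

end TropLimit

end

theorem mainTheorem1 {K : Type w} [Field K] (v : AddValuation K (WithTop ℝ))
    (A : Type u) [CommRing A] [Algebra K A] :
    -- (1) the initial embedding
    (Nonempty (IsInitial (hat K A)) ∧
      (IsDomain A → ∃ h : isIntegral (hat K A),
        Nonempty (IsInitial (⟨hat K A, h⟩ : (isIntegral (K := K) (A := A)).FullSubcategory)))) ∧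
    -- (2) the set-theoretic tropicalization is the analytification
    (∃ e : setTrop v (ev K A) ≃ Analytification v A, ∀ p a, (e p) a = p.1 a) ∧
    -- (2') so is the set of `𝕋`-points of the scheme-theoretic tropicalization
    (∃ e : (TropAlg v (ev K A) →ₐ[Trp] Trp) ≃ Analytification v A,
      ∀ h a, (e h) a = h (tropMk v (ev K A) (MonAlg.mon Trp a))) ∧
    -- (2'') points with values in `S` are semivaluations with values in `S`
    (∀ (S : Type s) [CommSemiring S] [Algebra Trp S],
      ∃ e : (TropAlg v (ev K A) →ₐ[Trp] S) ≃ VSemivaluation v A S,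
        ∀ h a, (e h) a = h (tropMk v (ev K A) (MonAlg.mon Trp a))) ∧
    -- (2''') the universal semivaluation
    (∃ U : VSemivaluation v A (TropAlg v (ev K A)),
      (∀ a, U a = tropMk v (ev K A) (MonAlg.mon Trp a)) ∧
      ∀ (S : Type s) [CommSemiring S] [Algebra Trp S] (x : VSemivaluation v A S),
        ∃! h : TropAlg v (ev K A) →ₐ[Trp] S, ∀ a, h (U a) = x a) ∧
    -- (3) the limit over all embeddings into affine spaces
    (Algebra.FiniteType K A → Nonempty (IsLimit (tropCone (K := K) (A := A) v))) := by
  refine ⟨⟨⟨hatIsInitial K A⟩, fun _ => ⟨isIntegral_hat K A, ⟨hatIsInitialFull K A _ _⟩⟩⟩,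
    ⟨(setTropEquiv v (ev K A)).trans (pointsEquiv v A Trp), fun p a => setTropEquiv_mon v _ p a⟩,
    ⟨pointsEquiv v A Trp, fun _ _ => rfl⟩, fun S _ _ => ⟨pointsEquiv v A S, fun _ _ => rfl⟩,
    ⟨univSemivaluation v A, fun _ => rfl, fun S _ _ x => ⟨x.toAlgHom, x.toAlgHom_mon, ?_⟩⟩,
    fun _ => nonempty_isLimit_tropCone v⟩
  exact fun h hh => tropAlg_hom_ext fun a => (hh a).trans (x.toAlgHom_mon a).symm
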